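/- Write $\mathbb{C}_+=\{z\in\mathbb{C}:\operatorname{Re}z>0\}$ and $\mathbb{R}_+=[0,\infty)$. For $n\in\mathbb{Z}$ let $\varphi_n:\mathbb{R}_+\to[0,1]$ be the continuous function that vanishes outside $[2^{n-1},2^{n+1}]$, equals $1$ at $2^n$, and is linear on $[2^{n-1},2^n]$ and on $[2^n,2^{n+1}]$. Let $\mathcal{L}\varphi(z)=\int_0^\infty e^{-zs}\varphi(s)\,ds$ and $\mathcal{L}\mu(z)=\int_{\mathbb{R}_+}e^{-zs}\,\mu(ds)$ denote Laplace transforms, and for $f$ bounded and holomorphic on $\mathbb{C}_+$ put $$(\mathcal{L}\varphi_n*f)(z)=\frac1{2\pi}\int_{\mathbb{R}}\mathcal{L}\varphi_n(it)\,f(z-it)\,dt\qquad(z\in\mathbb{C}_+).$$ For $s\ge 0$ the mixed-order homogeneous Besov space $\mathrm{B}^{0,s}_{\infty,1}(\mathbb{C}_+)$ consists of the bounded holomorphic functions $f$ on $\mathbb{C}_+$ for which $f(\infty):=\lim_{t\to+\infty}f(t)$ exists and $$\|f\|_{\mathrm{B}^{0,s}_{\infty,1}}:=|f(\infty)|+\sum_{n<0}\|\mathcal{L}\varphi_n*f\|_{\mathrm{H}^\infty(\mathbb{C}_+)}+\sum_{n\ge0}2^{ns}\|\mathcal{L}\varphi_n*f\|_{\mathrm{H}^\infty(\mathbb{C}_+)}<\infty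 ,$$ where $\|g\|_{\mathrm{H}^\infty(\mathbb{C}_+)}=\sup_{z\in\mathbb{C}_+}|g(z)|$. If $-A$ generates a strongly continuous semigroup $(T(s))_{s\ge0}$ and $f=\mathcal{L}\mu$ for a bounded complex Borel measure $\mu$ on $\mathbb{R}_+$ with $\int_{\mathbb{R}_+}\|T(s)\|\,|\mu|(ds)<\infty$, write $f(A)x:=\int_{\mathbb{R}_+}T(s)x\,\mu(ds)$ for all vectors $x$. **Theorem.** There is an absolute constant $c\ge0$ such that the following holds for every complex Hilbert space $X$ and every generator $-A$ of a strongly continuous semigroup $(T(s))_{s\ge0}$ on $X$. (a) If $\|T(s)\|\le M(1+s)^\alpha$ for all $s\ge0$, with $M\ge1$ and $\alpha\ge0$, then for every bounded complex Borel measure $\mu$ on $\mathbb{R}_+$ of compact support the function $f=\mathcal{L}\mu$ belongs to $\mathrm{B}^{0,2\alpha}_{\infty,1}(\mathbb{C}_+)$, the operator $f(A)$ is well defined and bounded, and $$\|f(A)\|\le c\,9^\alpha\,M^2\,\|f\|_{\mathrm{B}^{0,2\alpha}_{\infty,1}(\mathbb{C}_+)}.$$ (b) (The bounded case $\alpha=0$.)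 If $\|T(s)\|\le M$ for all $s\ge0$, then for every bounded complex Borel measure $\mu$ on $\mathbb{R}_+$, with $f=\mathcal{L}\mu$, the operator $f(A)$ is well defined and bounded, and $$\|f(A)\|\le c\,M^2\,\|f\|_{\mathrm{B}^{0,0}_{\infty,1}(\mathbb{C}_+)},$$ where the right-hand side is read as $+\infty$ when the defining sum of the norm diverges. -/

import Mathlib

open Filter Topology MeasureTheory
open scoped NNReal ENNReal

universe u

noncomputable section

namespace BesovCalculus

/-! ### Semigroups, generators and the Hille-Phillips calculus -/

section Semigroups

variable {X : Type u} [NormedAddCommGroup X] [NormedSpace ℂ X]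

/-- A strongly continuous one-parameter semigroup of bounded operators on `X`. -/
structure IsC0Semigroup (T : ℝ≥0 → X →L[ℂ] X) : Prop where
  map_zero : T 0 = 1
  map_add : ∀ s t : ℝ≥0, T (s + t) = T s * T t
  continuous_orbit : ∀ x : X, Continuous fun s => T s x

/-- The (possibly unbounded) operator `B` is the generator of `T`: one has `x ∈ dom B` and
`B x = y` if and only if `(T h x - x) / h → y` as `h → 0`, `h > 0`. -/
def IsGenerator (T : ℝ≥0 → X →L[ℂ] X) (B : X →ₗ.[ℂ] X) : Prop :=
  ∀ x y : X, (x, y) ∈ B.graph ↔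
    Tendsto (fun h : ℝ≥0 => (((h : ℝ) : ℂ))⁻¹ • (T h x - x)) (𝓝[>] 0) (𝓝 y)

/-- The integral `∫ F(s) μ(ds)` over `[0, ∞)` of a vector-valued function with respect to a
complex measure. -/
def cintegral (μ : ComplexMeasure ℝ≥0) (F : ℝ≥0 → X) : X :=
  VectorMeasure.integral μ F (ContinuousLinearMap.lsmul ℝ ℂ (E := X)).flip

/-- The bounded operator `S` is `f(A) = ∫ T(s) μ(ds)` for `f = ℒμ` and `-A` the generator of `T`:
all orbits of `T` are integrable with respect to the total variation `|μ|`,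
and `S x = ∫ T(s) x μ(ds)` for all `x`. -/
def IsHillePhillips (T : ℝ≥0 → X →L[ℂ] X) (μ : ComplexMeasure ℝ≥0) (S : X →L[ℂ] X) : Prop :=
  ∀ x : X, VectorMeasure.Integrable μ (fun s => T s x) ∧ S x = cintegral μ fun s => T s x

end Semigroups

/-! ### Laplace transforms -/

/-- The Laplace(-Stieltjes) transform `ℒμ(z) = ∫ exp(-zs) μ(ds)` of a complex measure on
`[0, ∞)`. -/
def laplaceMeasure (μ : ComplexMeasure ℝ≥0) (z : ℂ) : ℂ :=
  cintegral μ fun s => Complex.exp (-z * ((s : ℝ) : ℂ))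

/-- The Laplace transform `ℒφ(z) = ∫₀^∞ exp(-zs) φ(s) ds` of a function. -/
def laplace (φ : ℝ → ℝ) (z : ℂ) : ℂ :=
  ∫ s in Set.Ioi (0 : ℝ), Complex.exp (-z * (s : ℂ)) * ((φ s : ℝ) : ℂ)

/-! ### The mixed-order homogeneous analytic Besov space on the right half-plane -/

/-- The open right half-plane. -/
def rightHalfPlane : Set ℂ := {z | 0 < z.re}

/-- The supremum (with values in `[0, ∞]`) of `|f|` over the right half-plane. -/
def supNorm (f : ℂ → ℂ) : ℝ≥0∞ := ⨆ z ∈ rightHalfPlane, ‖f z‖ₑ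

/-- The dyadic partition of unity on `(0, ∞)`: `hat n` vanishes outside `[2^(n-1), 2^(n+1)]`,
takes the value `1` at `2^n`, and is linear in between. -/
def hat (n : ℤ) (s : ℝ) : ℝ :=
  if s ≤ 2 ^ (n - 1) then 0
  else if s ≤ 2 ^ n then 1 / 2 ^ (n - 1) * (s - 2 ^ (n - 1))
  else if s ≤ 2 ^ (n + 1) then 1 / 2 ^ n * (2 ^ (n + 1) - s)
  else 0

/-- The convolution `g * f` of functions on the right half-plane, taken along vertical lines,
where `g` is also defined on the imaginary axis:
`(g * f)(z) = (1/2π) ∫ g(it) f(z - it) dt`. The normalization is the one for which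
`ℒφ * ℒμ = ℒ(φμ)`. -/
def halfPlaneConv (g f : ℂ → ℂ) (z : ℂ) : ℂ :=
  (1 / (2 * Real.pi : ℝ) : ℂ) *
    ∫ t : ℝ, g (Complex.I * (t : ℂ)) * f (z - Complex.I * (t : ℂ))

/-- `f(∞) = lim f(t)` as `t → +∞` along the reals. -/
def valueAtInfinity (f : ℂ → ℂ) : ℂ := limUnder atTop fun t : ℝ => f (t : ℂ)

/-- The norm of `f` in `B^{0,s}_{∞,1}(ℂ₊)`, with values in `[0, ∞]`:
`|f(∞)| + ∑_{n<0} ‖ℒφₙ * f‖_∞ + ∑_{n≥0} 2^{ns} ‖ℒφₙ * f‖_∞`, where `φₙ = hat n`. -/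
def besovNorm (s : ℝ) (f : ℂ → ℂ) : ℝ≥0∞ :=
  ‖valueAtInfinity f‖ₑ
    + ∑' k : ℕ, supNorm (halfPlaneConv (laplace (hat (-((k : ℤ) + 1)))) f)
    + ∑' k : ℕ, (2 : ℝ≥0∞) ^ ((k : ℝ) * s) * supNorm (halfPlaneConv (laplace (hat (k : ℤ))) f)

/-- Membership in the Besov space `B^{0,s}_{∞,1}(ℂ₊)`: `f` is a bounded holomorphic function on
the right half-plane, the limit `f(∞)` exists and the norm is finite. -/
structure MemBesov (s : ℝ) (f : ℂ → ℂ) : Prop where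
  differentiableOn : DifferentiableOn ℂ f rightHalfPlane
  bounded : supNorm f < ∞
  exists_limit : ∃ l : ℂ, Tendsto (fun t : ℝ => f (t : ℂ)) atTop (𝓝 l)
  norm_lt_top : besovNorm s f < ∞

end BesovCalculus

end

/-! Write μ = h·|μ| with |h| ≤ 1, so that integrals against μ become Bochner integrals against a
finite positive measure. The hats φₙ sum to 1 on (0, ∞) and vanish at 0, hence f(A)x = f(∞)x + ∑ₙ ∫
φₙ(s) T(s)x μ(ds): the atom of μ at 0 has mass f(∞), and T(0) = 1. Fourier inversion and Fubini
identify ℒφₙ * f with ℒ(φₙμ) (`halfPlaneConv_laplace_hat`), so it remains to bound each dyadic block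
by the supremum of the Laplace transform of its own measure.

This is transference (`norm_integral_semigroup_le`). If k lives on [a, b] and Z = ∫ T(s)x k(ds), the
factorization T(s) = T(t)T(s-t) for 0 ≤ t ≤ a gives Z = T(t)(k * u)(t), where u is the reversed
orbit r ↦ T(-r)x on [-b, 0]. Averaging over t ∈ [0, a] brings in the L² norm of k * u, and
Plancherel in L²(ℝ; X), valid because X is Hilbert, bounds convolution by the supremum of the
Fourier transform of k. The resulting constant is √(b/a) times bounds for ‖T‖ on [0, a] and on [0,
b].

For a = 2^(n-1), b = 2^(n+1) the root is 2 for every n, and the two growth bounds multiply to at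
most M²·9^α for n < 0 and M²·9^α·2^(2αn) for n ≥ 0. These are the weights of the Besov norm, so c =
2 works. -/

namespace BesovCalculus

/-! ### Polar decomposition of a complex measure -/

section Density

variable {Ω : Type*} [MeasurableSpace Ω]

theorem isFiniteMeasure_variation (μ : ComplexMeasure Ω) : IsFiniteMeasure μ.variation := by
  have h : μ.variation ≤ (ComplexMeasure.re μ).totalVariation
      + (ComplexMeasure.im μ).totalVariation := by
    refine VectorMeasure.variation_le_of_forall_enorm_le fun E hE => ?_
    have h1 := SignedMeasure.enorm_le_totalVariation (ComplexMeasure.re μ) E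
    have h2 := SignedMeasure.enorm_le_totalVariation (ComplexMeasure.im μ) E
    have h3 : μ E = ((ComplexMeasure.re μ E : ℝ) : ℂ) + (ComplexMeasure.im μ E : ℝ) * Complex.I := by
      exact (Complex.re_add_im (μ E)).symm
    calc ‖μ E‖ₑ ≤ ‖((ComplexMeasure.re μ E : ℝ) : ℂ)‖ₑ
          + ‖(ComplexMeasure.im μ E : ℝ) * Complex.I‖ₑ := by rw [h3]; exact enorm_add_le _ _
      _ = ‖ComplexMeasure.re μ E‖ₑ + ‖ComplexMeasure.im μ E‖ₑ := by
          simp [← ofReal_norm]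
      _ ≤ _ := add_le_add h1 h2
  exact isFiniteMeasure_of_le _ h

/-- Radon-Nikodym for the real and imaginary parts gives a density g with respect to |μ|. The bound
on it comes from the variation of g·|μ| being |g|·|μ|. -/
theorem exists_density (μ : ComplexMeasure Ω) :
    ∃ h : Ω → ℂ, Measurable h ∧ (∀ s, ‖h s‖ ≤ 1) ∧
      ∀ E, MeasurableSet E → μ E = ∫ s in E, h s ∂μ.variation := by
  have := isFiniteMeasure_variation μ
  set ν := μ.variation with hν
  have hac : ∀ E, ν E = 0 → μ E = 0 := fun E hE => by
    have := VectorMeasure.enorm_measure_le_variation μ E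
    rw [← hν, hE] at this
    simpa using this
  have hre : ν.withDensityᵥ ((ComplexMeasure.re μ).rnDeriv ν) = ComplexMeasure.re μ := by
    refine SignedMeasure.withDensityᵥ_rnDeriv_eq _ _ (VectorMeasure.AbsolutelyContinuous.mk ?_)
    intro E hE h0
    rw [Measure.toENNRealVectorMeasure_apply_measurable hE] at h0
    change (μ E).re = 0
    simp [hac E h0]
  have him : ν.withDensityᵥ ((ComplexMeasure.im μ).rnDeriv ν) = ComplexMeasure.im μ := by
    refine SignedMeasure.withDensityᵥ_rnDeriv_eq _ _ (VectorMeasure.AbsolutelyContinuous.mk ?_)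
    intro E hE h0
    rw [Measure.toENNRealVectorMeasure_apply_measurable hE] at h0
    change (μ E).im = 0
    simp [hac E h0]
  set g := ComplexMeasure.rnDeriv μ ν with hg
  have hgi : Integrable g ν := ComplexMeasure.integrable_rnDeriv μ ν
  have hgm : Measurable g := by
    have h1 := SignedMeasure.measurable_rnDeriv (ComplexMeasure.re μ) ν
    have h2 := SignedMeasure.measurable_rnDeriv (ComplexMeasure.im μ) ν
    have : g = fun x => (((ComplexMeasure.re μ).rnDeriv ν x : ℝ) : ℂ)
        + ((ComplexMeasure.im μ).rnDeriv ν x : ℝ) * Complex.I := by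
      ext x
      exact (Complex.re_add_im (g x)).symm
    rw [this]
    fun_prop
  have hμ : ν.withDensityᵥ g = μ := by
    ext i hi : 1
    rw [withDensityᵥ_apply hgi hi]
    apply Complex.ext
    · rw [← RCLike.re_eq_complex_re, ← integral_re hgi.integrableOn, RCLike.re_eq_complex_re]
      have := congrArg (fun m : SignedMeasure Ω => m i) hre
      beta_reduce at this
      rw [withDensityᵥ_apply (SignedMeasure.integrable_rnDeriv _ _) hi] at this
      exact this
    · rw [← RCLike.im_eq_complex_im, ← integral_im hgi.integrableOn, RCLike.im_eq_complex_im]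
      have := congrArg (fun m : SignedMeasure Ω => m i) him
      beta_reduce at this
      rw [withDensityᵥ_apply (SignedMeasure.integrable_rnDeriv _ _) hi] at this
      exact this
  have hvar := Measure.variation_withDensityᵥ hgi
  rw [hμ, ← hν] at hvar
  -- |g|·ν = ν, and densities are unique up to null sets.
  have h1 : (fun s => ‖g s‖ₑ) =ᵐ[ν] 1 := by
    refine (withDensity_eq_iff_of_sigmaFinite (by fun_prop) (by fun_prop)).1 ?_
    rw [withDensity_one, ← hvar]
  -- Cutting g off on a null set makes the bound hold everywhere.
  refine ⟨Set.indicator {s | ‖g s‖ ≤ 1} g, hgm.indicator (measurableSet_le hgm.norm (by fun_prop)),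
    fun s => ?_, fun E hE => ?_⟩
  · by_cases hs : ‖g s‖ ≤ 1
    · rw [Set.indicator_of_mem (by exact hs)]; exact hs
    · rw [Set.indicator_of_notMem (by exact hs)]; simp
  · conv_lhs => rw [← hμ, withDensityᵥ_apply hgi hE]
    refine setIntegral_congr_ae hE ?_
    filter_upwards [h1] with s hs _
    rw [Set.indicator_of_mem]
    simp only [Pi.one_apply, ← ofReal_norm, ENNReal.ofReal_eq_one] at hs
    exact hs.le

end Density

/-- The integral against a complex measure with a bounded density. -/
theorem cintegral_eq_integral {X : Type*} [NormedAddCommGroup X] [NormedSpace ℂ X]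
    [CompleteSpace X] {μ : ComplexMeasure ℝ≥0} {h : ℝ≥0 → ℂ} (hm : Measurable h)
    (hb : ∀ s, ‖h s‖ ≤ 1) (hμ : ∀ E, MeasurableSet E → μ E = ∫ s in E, h s ∂μ.variation)
    {F : ℝ≥0 → X} (hF : Integrable F μ.variation) :
    cintegral μ F = ∫ s, h s • F s ∂μ.variation := by
  have := isFiniteMeasure_variation μ
  have hsmul : ∀ {G : ℝ≥0 → X}, Integrable G μ.variation →
      Integrable (fun s => h s • G s) μ.variation := fun {G} hG =>
    hG.bdd_smul 1 hm.aestronglyMeasurable (ae_of_all _ hb)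
  have hhi : Integrable h μ.variation :=
    Integrable.of_bound hm.aestronglyMeasurable 1 (ae_of_all _ hb)
  refine Integrable.induction
    (P := fun F => cintegral μ F = ∫ s, h s • F s ∂μ.variation) ?_ ?_ ?_ ?_ hF
  · intro c s hs hfin
    have h1 : (fun x => h x • s.indicator (fun _ => c) x) = s.indicator (fun x => h x • c) := by
      ext x
      by_cases hx : x ∈ s <;> simp [hx]
    rw [h1, integral_indicator hs, integral_smul_const, ← hμ s hs]
    unfold cintegral
    rw [VectorMeasure.integral_eq_setToFun, setToFun_indicator_const _ hs hfin.ne]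
    rfl
  · intro f g _ hf hg h1 h2
    have : cintegral μ (f + g) = cintegral μ f + cintegral μ g :=
      VectorMeasure.integral_add hf hg
    rw [this, h1, h2, ← integral_add (hsmul hf) (hsmul hg)]
    simp
  -- Both sides are continuous on L¹; the right side is 1-Lipschitz because |h| ≤ 1.
  · refine isClosed_eq VectorMeasure.continuous_integral ?_
    refine (LipschitzWith.of_dist_le_mul (K := 1) fun f g => ?_).continuous
    rw [dist_eq_norm, ← integral_sub (hsmul (L1.integrable_coeFn f)) (hsmul (L1.integrable_coeFn g)),
      L1.dist_eq_integral_dist]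
    simp only [NNReal.coe_one, one_mul]
    refine norm_integral_le_of_norm_le ?_ (ae_of_all _ fun s => ?_)
    · have := ((L1.integrable_coeFn f).sub (L1.integrable_coeFn g)).norm
      simpa [dist_eq_norm] using this
    · rw [← smul_sub, norm_smul, dist_eq_norm]
      exact mul_le_of_le_one_left (norm_nonneg _) (hb s)
  · intro f g hfg hf h1
    have e1 : cintegral μ f = cintegral μ g := VectorMeasure.integral_congr_ae hfg
    rw [← e1, h1]
    refine integral_congr_ae ?_
    filter_upwards [hfg] with s hs
    rw [hs]

/-! ### Plancherel and convolution operators on L²(ℝ; X) -/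

section Plancherel

open FourierTransform

variable {X : Type*} [NormedAddCommGroup X] [InnerProductSpace ℂ X]

/-- The conjugate is there because the inner product is conjugate-linear in its first slot: pairing
with W then integrates m against ⟨V, U⟩. -/
theorem exists_Lp_smul {m : ℝ → ℂ} {C : ℝ} (hm : AEStronglyMeasurable m volume)
    (hC : ∀ ξ, ‖m ξ‖ ≤ C) (V : Lp X 2 (volume : Measure ℝ)) :
    ∃ W : Lp X 2 (volume : Measure ℝ), (∀ᵐ ξ, W ξ = (starRingEnd ℂ (m ξ)) • V ξ) ∧
      ‖W‖ ≤ C * ‖V‖ := by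
  have hb : ∀ ξ, ‖(starRingEnd ℂ (m ξ)) • V ξ‖ ≤ C * ‖V ξ‖ := fun ξ => by
    rw [norm_smul, RCLike.norm_conj]
    gcongr
    exact hC ξ
  have hmem : MemLp (fun ξ => (starRingEnd ℂ (m ξ)) • V ξ) 2 (volume : Measure ℝ) :=
    (Lp.memLp V).of_le_mul
      ((RCLike.continuous_conj.comp_aestronglyMeasurable hm).smul (Lp.aestronglyMeasurable V))
      (ae_of_all _ hb)
  refine ⟨hmem.toLp _, hmem.coeFn_toLp, ?_⟩
  refine Lp.norm_le_mul_norm_of_ae_le_mul ?_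
  filter_upwards [hmem.coeFn_toLp] with ξ hξ
  rw [hξ]
  exact hb ξ

theorem norm_integral_mul_inner_le {m : ℝ → ℂ} {C : ℝ} (hm : AEStronglyMeasurable m volume)
    (hC : ∀ ξ, ‖m ξ‖ ≤ C) (V U : Lp X 2 (volume : Measure ℝ)) :
    ‖∫ ξ, m ξ * inner ℂ (V ξ) (U ξ)‖ ≤ C * ‖V‖ * ‖U‖ := by
  obtain ⟨W, hW, hW'⟩ := exists_Lp_smul hm hC V
  have : ∫ ξ, m ξ * inner ℂ (V ξ) (U ξ) = inner ℂ W U := by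
    rw [L2.inner_def]
    refine integral_congr_ae ?_
    filter_upwards [hW] with ξ hξ
    rw [hξ, inner_smul_left]
    simp
  rw [this]
  exact (norm_inner_le_norm _ _).trans (by gcongr)

theorem fourier_comp_sub (f : ℝ → X) (s ξ : ℝ) :
    𝓕 (fun t => f (t - s)) ξ = Complex.exp (-(2 * Real.pi * s * ξ : ℝ) * Complex.I) • 𝓕 f ξ := by
  rw [Real.fourier_real_eq_integral_exp_smul, Real.fourier_real_eq_integral_exp_smul,
    ← integral_smul]
  refine Eq.trans ?_ (integral_sub_right_eq_self _ s)
  refine integral_congr_ae (ae_of_all _ fun t => ?_)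
  simp only
  rw [smul_smul, ← Complex.exp_add]
  congr 2
  push_cast
  ring

variable [CompleteSpace X]

/-- Parseval, with translation becoming modulation. Both sides are continuous in u for fixed v, so
it suffices to take u Schwartz, where the Fourier transform is an honest integral. -/
theorem integral_inner_translate (v u : Lp X 2 (volume : Measure ℝ)) (s : ℝ) :
    ∫ t, inner ℂ (v t) (u (t - s)) =
      ∫ ξ, Complex.exp (-(2 * Real.pi * s * ξ : ℝ) * Complex.I) *
        inner ℂ ((𝓕 v : Lp X 2 (volume : Measure ℝ)) ξ)
          ((𝓕 u : Lp X 2 (volume : Measure ℝ)) ξ) := by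
  have hmp : MeasurePreserving (fun t : ℝ => t - s) volume volume :=
    measurePreserving_sub_right volume s
  have h1 : ∀ u : Lp X 2 (volume : Measure ℝ), ∫ t, inner ℂ (v t) (u (t - s)) =
      inner ℂ v (Lp.compMeasurePreserving _ hmp u) := fun u => by
    rw [L2.inner_def]
    refine integral_congr_ae ?_
    filter_upwards [Lp.coeFn_compMeasurePreserving u hmp] with t ht
    rw [ht]
    rfl
  have hnorm : ∀ ξ : ℝ, ‖Complex.exp (-(2 * Real.pi * s * ξ : ℝ) * Complex.I)‖ ≤ 1 := fun ξ => by
    rw [← Complex.ofReal_neg, Complex.norm_exp_ofReal_mul_I]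
  obtain ⟨W, hW, -⟩ := exists_Lp_smul
    (m := fun ξ : ℝ => Complex.exp (-(2 * Real.pi * s * ξ : ℝ) * Complex.I))
    (by fun_prop) hnorm (𝓕 v : Lp X 2 (volume : Measure ℝ))
  have h2 : ∀ u : Lp X 2 (volume : Measure ℝ),
      ∫ ξ, Complex.exp (-(2 * Real.pi * s * ξ : ℝ) * Complex.I) *
        inner ℂ ((𝓕 v : Lp X 2 (volume : Measure ℝ)) ξ)
          ((𝓕 u : Lp X 2 (volume : Measure ℝ)) ξ) = inner ℂ W (𝓕 u) := fun u => by
    rw [L2.inner_def]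
    refine integral_congr_ae ?_
    filter_upwards [hW] with ξ hξ
    rw [hξ, inner_smul_left, Complex.conj_conj]
  rw [h1, h2]
  refine DenseRange.induction_on (p := fun u : Lp X 2 (volume : Measure ℝ) =>
    inner ℂ v (Lp.compMeasurePreserving _ hmp u) = inner ℂ W (𝓕 u))
    (SchwartzMap.denseRange_toLpCLM (p := 2) ENNReal.ofNat_ne_top) u ?_ fun f => ?_
  · exact isClosed_eq
      (continuous_const.inner (Lp.isometry_compMeasurePreserving hmp).continuous)
      (continuous_const.inner (continuous_fourier (E := Lp X 2 (volume : Measure ℝ))))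
  · rw [SchwartzMap.toLpCLM_apply, ← h2]
    have e1 : Lp.compMeasurePreserving _ hmp (f.toLp 2) =
        (SchwartzMap.compSubConstCLM ℂ s f).toLp 2 := by
      refine Lp.ext ?_
      filter_upwards [Lp.coeFn_compMeasurePreserving (f.toLp 2 volume) hmp,
        (SchwartzMap.compSubConstCLM ℂ s f).coeFn_toLp 2 volume,
        hmp.quasiMeasurePreserving.ae (f.coeFn_toLp 2 volume)] with t h3 h4 h5
      rw [h3, h4]
      exact h5
    rw [e1, ← Lp.inner_fourier_eq, SchwartzMap.toLp_fourier_eq, SchwartzMap.toLp_fourier_eq,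
      L2.inner_def]
    refine integral_congr_ae ?_
    filter_upwards [(𝓕 (SchwartzMap.compSubConstCLM ℂ s f)).coeFn_toLp 2 volume,
      (𝓕 f).coeFn_toLp 2 volume] with ξ h3 h4
    rw [h3, h4, SchwartzMap.fourier_coe, SchwartzMap.fourier_coe]
    have := fourier_comp_sub (fun t => f t) s ξ
    change inner ℂ _ (𝓕 (fun t => f (t - s)) ξ) = _
    rw [this, inner_smul_right]

variable {Ω : Type*} [MeasurableSpace Ω] {ν : Measure Ω} [SFinite ν]

/-- Convolution operators on `L²(ℝ; X)` are bounded by the supremum of the Fourier transform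
of the measure, in weak form. -/
theorem norm_integral_mul_integral_inner_translate_le {k : Ω → ℂ} {q : Ω → ℝ}
    (hk : Integrable k ν) (hq : Measurable q) {C : ℝ}
    (hC : ∀ ω : ℝ, ‖∫ s, k s * Complex.exp (-(ω * q s : ℝ) * Complex.I) ∂ν‖ ≤ C)
    (v u : Lp X 2 (volume : Measure ℝ)) :
    ‖∫ s, (k s * ∫ t, inner ℂ (v t) (u (t - q s))) ∂ν‖ ≤ C * ‖v‖ * ‖u‖ := by
  set V : Lp X 2 (volume : Measure ℝ) := 𝓕 v with hV
  set U : Lp X 2 (volume : Measure ℝ) := 𝓕 u with hU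
  have hint : Integrable (fun p : ℝ × Ω => (inner ℂ (V p.1) (U p.1) * k p.2) *
      Complex.exp (-(2 * Real.pi * q p.2 * p.1 : ℝ) * Complex.I)) (volume.prod ν) := by
    refine ((L2.integrable_inner V U).mul_prod hk).mul_bdd (c := 1) ?_ (ae_of_all _ fun p => ?_)
    · have : Measurable fun p : ℝ × Ω => q p.2 := hq.comp measurable_snd
      exact Measurable.aestronglyMeasurable (by fun_prop)
    · rw [← Complex.ofReal_neg, Complex.norm_exp_ofReal_mul_I]
  -- After Fubini the Fourier transform of the measure appears as a multiplier on the frequency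
  -- side.
  have hsw : ∫ s, (k s * ∫ t, inner ℂ (v t) (u (t - q s))) ∂ν =
      ∫ ξ, (∫ s, k s * Complex.exp (-(2 * Real.pi * ξ * q s : ℝ) * Complex.I) ∂ν) *
        inner ℂ (V ξ) (U ξ) := by
    simp_rw [integral_inner_translate, ← integral_const_mul, ← integral_mul_const]
    rw [integral_integral_swap]
    · refine integral_congr_ae (ae_of_all _ fun ξ => integral_congr_ae (ae_of_all _ fun s => ?_))
      simp only [← hV, ← hU]
      rw [show 2 * Real.pi * q s * ξ = 2 * Real.pi * ξ * q s by ring]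
      ring
    · refine hint.swap.congr (ae_of_all _ fun p => ?_)
      simp only [Function.comp, Function.uncurry, Prod.fst_swap, Prod.snd_swap, ← hV, ← hU]
      ring
  rw [hsw, ← Lp.norm_fourier_eq v, ← Lp.norm_fourier_eq u]
  refine norm_integral_mul_inner_le ?_ (fun ξ => hC (2 * Real.pi * ξ)) V U
  have : AEStronglyMeasurable (fun p : ℝ × Ω =>
      k p.2 * Complex.exp (-(2 * Real.pi * p.1 * q p.2 : ℝ) * Complex.I)) (volume.prod ν) := by
    have h2 : Measurable fun p : ℝ × Ω => q p.2 := hq.comp measurable_snd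
    exact (hk.aestronglyMeasurable.comp_snd).mul (Measurable.aestronglyMeasurable (by fun_prop))
  exact this.integral_prod_right'

end Plancherel

/-! ### Transference from the semigroup to convolution on the line -/

section Transference

variable {X : Type*} [NormedAddCommGroup X]

theorem exists_Lp_indicator {f : ℝ → X} (hf : StronglyMeasurable f) {S : Set ℝ}
    (hS : MeasurableSet S) (hSfin : volume S < ∞) {B : ℝ} (hB : ∀ t, ‖f t‖ ≤ B) :
    Integrable (S.indicator f) volume ∧
    ∃ u : Lp X 2 (volume : Measure ℝ), (∀ᵐ t, u t = S.indicator f t) ∧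
      ‖u‖ ^ 2 = ∫ t in S, ‖f t‖ ^ 2 := by
  have : IsFiniteMeasure ((volume : Measure ℝ).restrict S) := ⟨by simpa using hSfin⟩
  have h : ∀ p : ℝ≥0∞, MemLp (S.indicator f) p (volume : Measure ℝ) := fun p =>
    (memLp_indicator_iff_restrict hS).2
      (MemLp.of_bound hf.aestronglyMeasurable B (ae_of_all _ hB))
  refine ⟨memLp_one_iff_integrable.1 (h 1), (h 2).toLp _, (h 2).coeFn_toLp, ?_⟩
  rw [Lp.norm_toLp, (h 2).eLpNorm_eq_integral_rpow_norm (by norm_num) (by norm_num)]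
  have h0 : 0 ≤ ∫ t, ‖S.indicator f t‖ ^ (2 : ℝ≥0∞).toReal := by positivity
  rw [ENNReal.toReal_ofReal (by positivity), ← Real.rpow_natCast, ← Real.rpow_mul h0]
  norm_num
  rw [← integral_indicator hS]
  refine integral_congr_ae (ae_of_all _ fun t => ?_)
  by_cases ht : t ∈ S <;> simp [ht]

variable [InnerProductSpace ℂ X] [CompleteSpace X]

/-- Transference: the integral of a semigroup on a Hilbert space against a measure with support
in `[a, b]` is controlled by the supremum of the Fourier transform of the measure. -/
theorem norm_integral_semigroup_le {T : ℝ≥0 → X →L[ℂ] X} (hT : IsC0Semigroup T)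
    {ν : Measure ℝ≥0} [IsFiniteMeasure ν] {k : ℝ≥0 → ℂ} (hk : Integrable k ν) {a b : ℝ}
    (ha : 0 < a) (hab : a ≤ b) (hsupp : ∀ s : ℝ≥0, k s ≠ 0 → a ≤ s ∧ (s : ℝ) ≤ b)
    {Ma Mb C : ℝ} (hMa : ∀ s : ℝ≥0, (s : ℝ) ≤ a → ‖T s‖ ≤ Ma)
    (hMb : ∀ s : ℝ≥0, (s : ℝ) ≤ b → ‖T s‖ ≤ Mb)
    (hC : ∀ ω : ℝ, ‖∫ s, k s * Complex.exp (-(ω * s : ℝ) * Complex.I) ∂ν‖ ≤ C) (x : X) :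
    ‖∫ s, k s • T s x ∂ν‖ ≤ √(b / a) * Ma * Mb * C * ‖x‖ := by
  have hC0 : 0 ≤ C := (norm_nonneg _).trans (hC 0)
  have hMa0 : 0 ≤ Ma := (norm_nonneg _).trans (hMa 0 (by simpa using ha.le))
  have hMb0 : 0 ≤ Mb := (norm_nonneg _).trans (hMb 0 (by simpa using ha.le.trans hab))
  have hb : 0 < b := ha.trans_le hab
  -- The reversed orbit. Clamping the time to [0, b] keeps it continuous and bounded on all of ℝ,
  -- and changes nothing on [-b, 0].
  set u₁ : ℝ → X := fun r => T (min (Real.toNNReal (-r)) (Real.toNNReal b)) x with hu₁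
  have hu₁c : Continuous u₁ := (hT.continuous_orbit x).comp (by fun_prop)
  have hu₁b : ∀ r, ‖u₁ r‖ ≤ Mb * ‖x‖ := fun r =>
    (T _).le_of_opNorm_le (hMb _ (by
      refine le_trans (NNReal.coe_le_coe.2 (min_le_right _ _)) ?_
      rw [Real.coe_toNNReal _ hb.le])) x
  have hu₁m : StronglyMeasurable u₁ := hu₁c.stronglyMeasurable
  set u₀ : ℝ → X := (Set.Icc (-b) 0).indicator u₁ with hu₀
  have hu₀m : StronglyMeasurable u₀ := hu₁m.indicator measurableSet_Icc
  have hu₀b : ∀ r, ‖u₀ r‖ ≤ Mb * ‖x‖ := fun r =>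
    (Set.indicator_le_self' (fun _ _ => norm_nonneg _) r |>.trans' (by
      rw [hu₀, norm_indicator_eq_indicator_norm])).trans (hu₁b r)
  obtain ⟨-, u, hu, hunorm⟩ := exists_Lp_indicator hu₁m (measurableSet_Icc (a := -b) (b := 0))
    (by simp) hu₁b
  have hu_le : ‖u‖ ^ 2 ≤ b * (Mb * ‖x‖) ^ 2 := by
    rw [hunorm]
    calc ∫ t in Set.Icc (-b) 0, ‖u₁ t‖ ^ 2 ≤ ∫ t in Set.Icc (-b) 0, (Mb * ‖x‖) ^ 2 := by
          refine integral_mono_of_nonneg (ae_of_all _ fun t => by positivity)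
            (integrable_const _) (ae_of_all _ fun t => ?_)
          have := hu₁b t
          simp only
          gcongr
      _ = b * (Mb * ‖x‖) ^ 2 := by
          simp [hb.le]
  have hku : ∀ t : ℝ, Integrable (fun s : ℝ≥0 => k s • u₀ (t - s)) ν := fun t =>
    hk.smul_bdd (Mb * ‖x‖)
      (hu₀m.comp_measurable (g := fun s : ℝ≥0 => t - (s : ℝ)) (by fun_prop)).aestronglyMeasurable (ae_of_all _ fun s => hu₀b _)
  set G : ℝ → X := fun t => ∫ s, k s • u₀ (t - s) ∂ν with hG
  -- A genuinely measurable representative of k is needed for joint measurability in (t, s).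
  obtain ⟨k', hk'm, hkk'⟩ := hk.aestronglyMeasurable
  have hGm : StronglyMeasurable G := by
    have : G = fun t => ∫ s, k' s • u₀ (t - s) ∂ν := by
      ext t
      refine integral_congr_ae ?_
      filter_upwards [hkk'] with s hs
      rw [hs]
    rw [this]
    refine StronglyMeasurable.integral_prod_right (f := fun t (s : ℝ≥0) => k' s • u₀ (t - s)) ?_
    exact (hk'm.comp_measurable measurable_snd).smul (hu₀m.comp_measurable (by fun_prop))
  have hGb : ∀ t, ‖G t‖ ≤ (∫ s, ‖k s‖ ∂ν) * (Mb * ‖x‖) := fun t => by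
    rw [← integral_mul_const]
    refine norm_integral_le_of_norm_le (hk.norm.mul_const _) (ae_of_all _ fun s => ?_)
    rw [norm_smul]
    gcongr
    exact hu₀b _
  obtain ⟨hwi, w, hw, hwnorm⟩ := exists_Lp_indicator hGm (measurableSet_Icc (a := 0) (b := a))
    (by simp) hGb
  set w₀ : ℝ → X := (Set.Icc 0 a).indicator G with hw₀
  have hw₀m : StronglyMeasurable w₀ := hGm.indicator measurableSet_Icc
  -- w is G = k * u₀ cut to [0, a], so pairing it with the convolution gives its own squared norm.
  -- The convolution estimate for the pair (w, u) then reads ‖w‖² ≤ C‖w‖‖u‖.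
  have hswap : ∫ s, (k s * ∫ t, inner ℂ (w t) (u (t - s))) ∂ν = ((‖w‖ ^ 2 : ℝ) : ℂ) := by
    have e1 : ∀ s : ℝ≥0, ∫ t, inner ℂ (w t) (u (t - s)) = ∫ t, inner ℂ (w₀ t) (u₀ (t - s)) :=
      fun s => by
        refine integral_congr_ae ?_
        filter_upwards [hw, (measurePreserving_sub_right volume (s : ℝ)).quasiMeasurePreserving.ae hu]
          with t h1 h2
        rw [h1, h2]
    simp_rw [e1, ← integral_const_mul]
    rw [integral_integral_swap]
    · have e2 : ∀ t, ∫ s, k s * inner ℂ (w₀ t) (u₀ (t - s)) ∂ν = inner ℂ (w₀ t) (G t) := fun t => by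
        rw [hG, ← integral_inner (hku t)]
        simp only [inner_smul_right]
      simp_rw [e2]
      rw [hwnorm, ← integral_indicator measurableSet_Icc, ← integral_complex_ofReal]
      refine integral_congr_ae (ae_of_all _ fun t => ?_)
      by_cases ht : t ∈ Set.Icc 0 a
      · simp only [hw₀, Set.indicator_of_mem ht, inner_self_eq_norm_sq_to_K]
        simp
      · simp only [hw₀, Set.indicator_of_notMem ht]
        simp
    · refine ((hk.norm.mul_prod (hwi.norm)).mul_const (Mb * ‖x‖)).mono' ?_ (ae_of_all _ fun p => ?_)
      · refine (hk.aestronglyMeasurable.comp_fst).mul ?_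
        refine StronglyMeasurable.aestronglyMeasurable ?_
        exact (hw₀m.comp_measurable measurable_snd).inner (𝕜 := ℂ)
          (hu₀m.comp_measurable (by fun_prop))
      · simp only [Function.uncurry, norm_mul]
        rw [mul_assoc]
        gcongr
        refine (norm_inner_le_norm _ _).trans ?_
        gcongr
        exact hu₀b _
  have hwu : ‖w‖ ≤ C * ‖u‖ := by
    have h1 := norm_integral_mul_integral_inner_translate_le hk (q := fun s : ℝ≥0 => (s : ℝ)) (by fun_prop) hC w u
    rw [hswap, Complex.norm_real, Real.norm_eq_abs, abs_of_nonneg (by positivity)] at h1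
    by_contra! h2
    have h3 : 0 < ‖w‖ := (by positivity : 0 ≤ C * ‖u‖).trans_lt h2
    nlinarith
  set Z := ∫ s, k s • T s x ∂ν with hZ
  -- For t ∈ [0, a] and s ∈ [a, b] the point t - s lies in [-b, 0], so T(t)u₀(t-s) = T(t)T(s-t)x =
  -- T(s)x.
  have hZG : ∀ t ∈ Set.Icc 0 a, ‖Z‖ ≤ Ma * ‖G t‖ := fun t ht => by
    have : Z = T t.toNNReal (G t) := by
      rw [hG, ← ContinuousLinearMap.integral_comp_comm _ (hku t), hZ]
      refine integral_congr_ae (ae_of_all _ fun s => ?_)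
      simp only [map_smul]
      by_cases hs : k s = 0
      · simp [hs]
      · obtain ⟨h1, h2⟩ := hsupp s hs
        have h3 : t - (s : ℝ) ∈ Set.Icc (-b) 0 := ⟨by linarith [ht.1], by linarith [ht.2]⟩
        rw [hu₀, Set.indicator_of_mem h3, hu₁]
        simp only
        rw [← mul_apply_eq_comp, ← hT.map_add]
        congr 3
        rw [min_eq_left (Real.toNNReal_le_toNNReal (by linarith [ht.1])), ← NNReal.coe_inj]
        rw [NNReal.coe_add, Real.coe_toNNReal _ ht.1, Real.coe_toNNReal _ (by linarith [ht.2])]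
        ring
    rw [this]
    exact (T _).le_of_opNorm_le (hMa _ (by rw [Real.coe_toNNReal _ ht.1]; exact ht.2)) _
  -- Integrate the square of the previous bound over t ∈ [0, a].
  have hZw : a * ‖Z‖ ^ 2 ≤ Ma ^ 2 * ‖w‖ ^ 2 := by
    rw [hwnorm, ← integral_const_mul]
    calc a * ‖Z‖ ^ 2 = ∫ t in Set.Icc 0 a, ‖Z‖ ^ 2 := by simp [ha.le]
      _ ≤ ∫ t in Set.Icc 0 a, Ma ^ 2 * ‖G t‖ ^ 2 := by
          refine setIntegral_mono_on (integrable_const _) ?_ measurableSet_Icc fun t ht => ?_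
          · refine Integrable.const_mul ?_ _
            refine Integrable.of_bound ((hGm.norm.pow 2).aestronglyMeasurable)
              (((∫ s, ‖k s‖ ∂ν) * (Mb * ‖x‖)) ^ 2) (ae_of_all _ fun t => ?_)
            rw [Real.norm_eq_abs, abs_of_nonneg (by positivity)]
            gcongr
            exact hGb t
          · rw [← mul_pow]
            gcongr
            exact hZG t ht
  have hfin : ‖Z‖ ^ 2 ≤ (√(b / a) * Ma * Mb * C * ‖x‖) ^ 2 := by
    have h1 : ‖w‖ ^ 2 ≤ C ^ 2 * (b * (Mb * ‖x‖) ^ 2) := by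
      calc ‖w‖ ^ 2 ≤ (C * ‖u‖) ^ 2 := by gcongr
        _ = C ^ 2 * ‖u‖ ^ 2 := mul_pow _ _ _
        _ ≤ _ := by gcongr
    have h2 : a * ‖Z‖ ^ 2 ≤ Ma ^ 2 * (C ^ 2 * (b * (Mb * ‖x‖) ^ 2)) := hZw.trans (by gcongr)
    have h3 : (√(b / a) * Ma * Mb * C * ‖x‖) ^ 2 = Ma ^ 2 * (C ^ 2 * (b * (Mb * ‖x‖) ^ 2)) / a := by
      simp only [mul_pow]
      rw [Real.sq_sqrt (by positivity)]
      ring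
    rw [h3, le_div_iff₀ ha]
    linarith
  exact (pow_le_pow_iff_left₀ (norm_nonneg _) (by positivity) two_ne_zero).1 hfin

end Transference

/-! ### The dyadic partition of unity and its Fourier transform -/

section Hat

theorem hat_eq_max (n : ℤ) (s : ℝ) :
    hat n s = max 0 (min ((s - 2 ^ (n - 1)) / 2 ^ (n - 1))
      ((4 * 2 ^ (n - 1) - s) / (2 * 2 ^ (n - 1)))) := by
  have e1 : (2 : ℝ) ^ n = 2 * 2 ^ (n - 1) := by
    rw [← zpow_one_add₀ two_ne_zero]; congr 1; ring
  have e2 : (2 : ℝ) ^ (n + 1) = 4 * 2 ^ (n - 1) := by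
    rw [zpow_add_one₀ two_ne_zero, e1]; ring
  have ha : (0 : ℝ) < 2 ^ (n - 1) := by positivity
  unfold hat
  rw [e1, e2]
  generalize (2 : ℝ) ^ (n - 1) = a at ha
  split_ifs with h1 h2 h3
  · rw [max_eq_left]
    exact (min_le_left _ _).trans (div_nonpos_of_nonpos_of_nonneg (by linarith) ha.le)
  · have h4 : (s - a) / a ≤ 1 := by rw [div_le_one ha]; linarith
    have h5 : 1 ≤ (4 * a - s) / (2 * a) := by rw [one_le_div (by positivity)]; linarith
    rw [min_eq_left (h4.trans h5), max_eq_right (div_nonneg (by linarith) ha.le)]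
    ring
  · have h4 : 1 ≤ (s - a) / a := by rw [one_le_div ha]; linarith
    have h5 : (4 * a - s) / (2 * a) ≤ 1 := by rw [div_le_one (by positivity)]; linarith
    rw [min_eq_right (h5.trans h4), max_eq_right (div_nonneg (by linarith) (by positivity))]
    ring
  · rw [max_eq_left]
    exact (min_le_right _ _).trans (div_nonpos_of_nonpos_of_nonneg (by linarith) (by positivity))

theorem continuous_hat (n : ℤ) : Continuous (hat n) := by
  have : hat n = fun s => max 0 (min ((s - 2 ^ (n - 1)) / 2 ^ (n - 1))
      ((4 * 2 ^ (n - 1) - s) / (2 * 2 ^ (n - 1)))) := funext (hat_eq_max n)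
  rw [this]
  fun_prop

theorem hat_nonneg (n : ℤ) (s : ℝ) : 0 ≤ hat n s := by
  rw [hat_eq_max]
  exact le_max_left _ _

theorem hat_of_le {n : ℤ} {s : ℝ} (h : s ≤ 2 ^ (n - 1)) : hat n s = 0 := by
  simp [hat, h]

theorem hat_of_ge {n : ℤ} {s : ℝ} (h : 2 ^ (n + 1) ≤ s) : hat n s = 0 := by
  have h1 : (2 : ℝ) ^ (n - 1) < 2 ^ (n + 1) := zpow_lt_zpow_right₀ one_lt_two (by lia)
  have h2 : (2 : ℝ) ^ n < 2 ^ (n + 1) := zpow_lt_zpow_right₀ one_lt_two (by lia)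
  unfold hat
  rw [if_neg (by linarith), if_neg (by linarith)]
  split_ifs with h3
  · rw [le_antisymm h3 h]; simp
  · rfl

theorem mem_Icc_of_hat_ne_zero {n : ℤ} {s : ℝ} (h : hat n s ≠ 0) :
    2 ^ (n - 1) ≤ s ∧ s ≤ 2 ^ (n + 1) := by
  constructor
  · by_contra! h1
    exact h (hat_of_le h1.le)
  · by_contra! h1
    exact h (hat_of_ge h1.le)

/-- The functions `hat n` form a partition of unity on `(0, ∞)`. -/
theorem hasSum_hat {s : ℝ} (hs : 0 < s) : HasSum (fun n : ℤ => hat n s) 1 := by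
  obtain ⟨m, hm1, hm2⟩ := exists_mem_Ioc_zpow hs one_lt_two
  -- For 2^m < s ≤ 2^(m+1) only the falling edge of `hat m` and the rising edge of `hat (m + 1)` are
  -- seen.
  have h : HasSum (fun n : ℤ => hat n s) (∑ n ∈ {m, m + 1}, hat n s) := by
    refine hasSum_sum_of_ne_finset_zero fun n hn => ?_
    simp only [Finset.mem_insert, Finset.mem_singleton, not_or] at hn
    rcases lt_or_gt_of_ne hn.1 with h1 | h1
    · exact hat_of_ge ((zpow_le_zpow_right₀ one_le_two (by lia)).trans hm1.le)
    · exact hat_of_le (hm2.trans (zpow_le_zpow_right₀ one_le_two (by lia)))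
  · rw [Finset.sum_pair (by simp)] at h
    convert h using 1
    have hp : (0 : ℝ) < 2 ^ m := by positivity
    have e1 : (2 : ℝ) ^ (m + 1) = 2 * 2 ^ m := by rw [zpow_add_one₀ two_ne_zero]; ring
    have e2 : (2 : ℝ) ^ (m - 1) < 2 ^ m := zpow_lt_zpow_right₀ one_lt_two (by lia)
    unfold hat
    rw [if_neg (by linarith), if_neg (by linarith), if_pos hm2, if_neg (by simpa using hm1),
      if_pos hm2, add_sub_cancel_right, e1]
    field_simp
    ring

theorem hat_le_one (n : ℤ) (s : ℝ) : hat n s ≤ 1 := by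
  rcases le_or_gt s 0 with hs | hs
  · rw [hat_of_le (hs.trans (by positivity))]
    exact zero_le_one
  · exact le_hasSum (hasSum_hat hs) n fun m _ => hat_nonneg m s

theorem hasCompactSupport_hat (n : ℤ) : HasCompactSupport (hat n) :=
  HasCompactSupport.intro (isCompact_Icc (a := 2 ^ (n - 1)) (b := 2 ^ (n + 1))) fun s hs => by
    by_contra h
    exact hs (mem_Icc_of_hat_ne_zero h)

theorem integrable_hat (n : ℤ) : Integrable (hat n) :=
  (continuous_hat n).integrable_of_hasCompactSupport (hasCompactSupport_hat n)

open FourierTransform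

theorem laplace_hat_I_mul (n : ℤ) (t : ℝ) :
    laplace (hat n) (Complex.I * t) = 𝓕 (fun s => (hat n s : ℂ)) (t / (2 * Real.pi)) := by
  rw [Real.fourier_real_eq_integral_exp_smul, laplace, ← integral_indicator measurableSet_Ioi]
  refine integral_congr_ae (ae_of_all _ fun s => ?_)
  by_cases hs : s ∈ Set.Ioi (0 : ℝ)
  · simp only [Set.indicator_of_mem hs, smul_eq_mul]
    congr 2
    push_cast
    field_simp
  · simp only [Set.indicator_of_notMem hs]
    rw [hat_of_le (le_trans (by simpa using hs) (by positivity))]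
    simp

theorem integral_exp_mul_affine {z : ℂ} (hz : z ≠ 0) (α β : ℂ) (p q : ℝ) :
    ∫ s in p..q, Complex.exp (-z * s) * (α * s + β) =
      -(Complex.exp (-z * q) * ((α * q + β) / z + α / z ^ 2)) +
        Complex.exp (-z * p) * ((α * p + β) / z + α / z ^ 2) := by
  have hd : ∀ s : ℝ, HasDerivAt
      (fun s : ℝ => -(Complex.exp (-z * s) * ((α * s + β) / z + α / z ^ 2)))
      (Complex.exp (-z * s) * (α * s + β)) s := fun s => by
    have h1 : HasDerivAt (fun s : ℂ => -(Complex.exp (-z * s) * ((α * s + β) / z + α / z ^ 2)))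
        (-(Complex.exp (-z * s) * (-z * 1) * ((α * s + β) / z + α / z ^ 2) +
          Complex.exp (-z * s) * (α * 1 / z))) (s : ℂ) :=
      ((((hasDerivAt_id _).const_mul (-z)).cexp).mul
        (((((hasDerivAt_id _).const_mul α).add_const β).div_const z).add_const _)).neg
    convert h1.comp_ofReal using 1
    field_simp
    ring
  rw [intervalIntegral.integral_eq_sub_of_hasDerivAt (fun s _ => hd s)
    (Continuous.intervalIntegrable (by fun_prop) _ _)]
  ring

/-- Two integrations by parts leave only the jumps of the slope. With a = 2^(n-1) these are 1/a,
-3/(2a), 1/(2a) at a, 2a, 4a, with absolute sum 3/a. -/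
theorem sq_mul_norm_laplace_hat_le (n : ℤ) (t : ℝ) :
    t ^ 2 * ‖laplace (hat n) (Complex.I * t)‖ ≤ 3 / 2 ^ (n - 1) := by
  set a : ℝ := 2 ^ (n - 1) with ha'
  have ha : 0 < a := by positivity
  rcases eq_or_ne t 0 with rfl | ht
  · simp; positivity
  set z : ℂ := Complex.I * t with hz'
  have hz : z ≠ 0 := by simp [hz', ht]
  have e1 : (2 : ℝ) ^ n = 2 * a := by
    rw [ha', ← zpow_one_add₀ two_ne_zero]; congr 1; ring
  have e2 : (2 : ℝ) ^ (n + 1) = 4 * a := by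
    rw [zpow_add_one₀ two_ne_zero, e1]; ring
  have hac : (a : ℂ) ≠ 0 := by exact_mod_cast ha.ne'
  have hcont : Continuous fun s : ℝ => Complex.exp (-z * s) * ((hat n s : ℝ) : ℂ) := by
    have := continuous_hat n
    fun_prop
  have hI : laplace (hat n) z = (∫ s in a..(2 * a), Complex.exp (-z * s) * ((hat n s : ℝ) : ℂ)) +
      ∫ s in (2 * a)..(4 * a), Complex.exp (-z * s) * ((hat n s : ℝ) : ℂ) := by
    rw [intervalIntegral.integral_add_adjacent_intervals (hcont.intervalIntegrable _ _)
      (hcont.intervalIntegrable _ _), intervalIntegral.integral_of_le (by linarith), laplace]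
    apply setIntegral_eq_of_subset_of_forall_sdiff_eq_zero measurableSet_Ioi
    · exact fun s hs => ha.trans hs.1
    · intro s hs
      have : hat n s = 0 := by
        by_contra h
        have := mem_Icc_of_hat_ne_zero h
        refine hs.2 ⟨lt_of_le_of_ne this.1 fun h3 => h (hat_of_le h3.ge), by linarith [this.2]⟩
      simp [this]
  have hI1 : ∫ s in a..(2 * a), Complex.exp (-z * s) * ((hat n s : ℝ) : ℂ) =
      ∫ s in a..(2 * a), Complex.exp (-z * s) * (1 / a * s + (-1)) := by
    refine intervalIntegral.integral_congr fun s hs => ?_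
    rw [Set.uIcc_of_le (by linarith)] at hs
    congr 1
    rcases hs.1.eq_or_lt with h | h
    · rw [hat_of_le h.ge, ← h]; field_simp; simp
    · unfold hat
      rw [if_neg (by linarith), if_pos (by linarith [hs.2])]
      push_cast [← ha']
      field_simp
      ring
  have hI2 : ∫ s in (2 * a)..(4 * a), Complex.exp (-z * s) * ((hat n s : ℝ) : ℂ) =
      ∫ s in (2 * a)..(4 * a), Complex.exp (-z * s) * (-(1 / (2 * a)) * s + 2) := by
    refine intervalIntegral.integral_congr fun s hs => ?_
    rw [Set.uIcc_of_le (by linarith)] at hs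
    congr 1
    rcases hs.1.eq_or_lt with h | h
    · unfold hat
      rw [if_neg (by linarith), if_pos (by linarith), ← h]
      rw [← ha']
      push_cast
      field_simp
      ring
    · unfold hat
      rw [if_neg (by linarith), if_neg (by linarith), if_pos (by linarith [hs.2]), e1, e2]
      push_cast
      field_simp
      ring
  have hsum : z ^ 2 * laplace (hat n) z = Complex.exp (-z * a) * (1 / a)
      - Complex.exp (-z * (2 * a : ℝ)) * (3 / (2 * a))
      + Complex.exp (-z * (4 * a : ℝ)) * (1 / (2 * a)) := by
    rw [hI, hI1, hI2, integral_exp_mul_affine hz, integral_exp_mul_affine hz]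
    push_cast
    field_simp
    ring
  have hexp : ∀ s : ℝ, ‖Complex.exp (-z * s)‖ = 1 := fun s => by
    have : -z * s = ((-(t * s) : ℝ) : ℂ) * Complex.I := by rw [hz']; push_cast; ring
    rw [this, Complex.norm_exp_ofReal_mul_I]
  have hn : t ^ 2 * ‖laplace (hat n) z‖ = ‖z ^ 2 * laplace (hat n) z‖ := by
    rw [norm_mul, norm_pow, hz', norm_mul, Complex.norm_I, one_mul, Complex.norm_real,
      Real.norm_eq_abs, sq_abs]
  rw [hn, hsum]
  refine (norm_add_le _ _).trans ((add_le_add (norm_sub_le _ _) le_rfl).trans (le_of_eq ?_))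
  simp only [norm_mul, hexp, norm_div, Complex.norm_real, Real.norm_eq_abs, abs_of_pos ha]
  norm_num
  field_simp
  norm_num

/-- The L¹ norm of the hat controls small t and the t⁻² decay controls large t. This integrability
justifies both Fourier inversion and Fubini. -/
theorem integrable_laplace_hat (n : ℤ) :
    Integrable fun t : ℝ => laplace (hat n) (Complex.I * t) := by
  have hint : Integrable fun s => (hat n s : ℂ) := (integrable_hat n).ofReal
  have hc : Continuous fun t : ℝ => laplace (hat n) (Complex.I * t) := by
    simp_rw [laplace_hat_I_mul]
    exact (VectorFourier.fourierIntegral_continuous Real.continuous_fourierChar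
      (L := innerₗ ℝ) continuous_inner hint).comp (by fun_prop)
  have hb : ∀ t : ℝ, ‖laplace (hat n) (Complex.I * t)‖ ≤ ∫ s, ‖(hat n s : ℂ)‖ := fun t => by
    rw [laplace_hat_I_mul]
    exact VectorFourier.norm_fourierIntegral_le_integral_norm _ _ _ _ _
  refine (integrable_inv_one_add_sq.const_mul ((∫ s, ‖(hat n s : ℂ)‖) + 3 / 2 ^ (n - 1))).mono'
    hc.aestronglyMeasurable (ae_of_all _ fun t => ?_)
  rw [← div_eq_mul_inv, le_div_iff₀ (by positivity)]
  linarith [hb t, sq_mul_norm_laplace_hat_le n t]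

theorem integral_laplace_hat_mul_exp (n : ℤ) (s : ℝ) :
    (1 / (2 * Real.pi : ℝ) : ℂ) * ∫ t : ℝ, laplace (hat n) (Complex.I * t) *
      Complex.exp ((t * s : ℝ) * Complex.I) = hat n s := by
  have hint : Integrable fun s => (hat n s : ℂ) := (integrable_hat n).ofReal
  have hc : Continuous fun s => (hat n s : ℂ) := Complex.continuous_ofReal.comp (continuous_hat n)
  have hF : Integrable (𝓕 fun s => (hat n s : ℂ)) := by
    have := (integrable_laplace_hat n).comp_mul_left' (R := 2 * Real.pi) (by positivity)
    refine this.congr (ae_of_all _ fun ξ => ?_)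
    simp only
    rw [laplace_hat_I_mul]
    field_simp
  have h := congrFun (hc.fourierInv_fourier_eq hint hF) s
  rw [Real.fourierInv_eq'] at h
  rw [← h]
  set g : ℝ → ℂ := fun ξ => Complex.exp ((2 * Real.pi * inner ℝ ξ s : ℝ) * Complex.I) •
    𝓕 (fun s => (hat n s : ℂ)) ξ with hg
  have e1 : ∀ t : ℝ, laplace (hat n) (Complex.I * t) * Complex.exp ((t * s : ℝ) * Complex.I) =
      g (t / (2 * Real.pi)) := fun t => by
    simp only [hg, smul_eq_mul, RCLike.inner_apply, conj_trivial]
    rw [laplace_hat_I_mul, mul_comm]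
    congr 4
    field_simp
  have key : ∀ g : ℝ → ℂ, (1 / (2 * Real.pi : ℝ) : ℂ) * ∫ t, g (t / (2 * Real.pi)) = ∫ ξ, g ξ :=
    fun g => by
      rw [Measure.integral_comp_div, abs_of_pos (by positivity), Complex.real_smul, ← mul_assoc,
        one_div_mul_cancel (by exact_mod_cast (by positivity : (2 * Real.pi : ℝ) ≠ 0)), one_mul]
  exact (congrArg _ (integral_congr_ae (ae_of_all _ e1))).trans (key g)

end Hat

/-! ### Convolution along vertical lines -/

section Convolution

variable {ν : Measure ℝ≥0} {h : ℝ≥0 → ℂ}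

theorem norm_exp_neg_mul_le_one {z : ℂ} (hz : 0 ≤ z.re) (s : ℝ≥0) :
    ‖Complex.exp (-z * ((s : ℝ) : ℂ))‖ ≤ 1 := by
  rw [Complex.norm_exp]
  simp only [neg_mul, Complex.neg_re, Complex.re_mul_ofReal, Real.exp_le_one_iff]
  have : 0 ≤ z.re * s := by positivity
  linarith

theorem integrable_mul_exp (hh : Integrable h ν) {z : ℂ} (hz : 0 ≤ z.re) :
    Integrable (fun s => h s * Complex.exp (-z * ((s : ℝ) : ℂ))) ν :=
  hh.mul_bdd (c := 1) (Measurable.aestronglyMeasurable (by fun_prop))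
    (ae_of_all _ (norm_exp_neg_mul_le_one hz))

variable [SFinite ν]

/-- Shifting z by -it multiplies the kernel of f by exp(its). By Fubini the t-integral can be done
first, and Fourier inversion turns it into φₙ(s). -/
theorem halfPlaneConv_laplace_hat (hh : Integrable h ν) {f : ℂ → ℂ}
    (hf : ∀ z, 0 < z.re → f z = ∫ s, h s * Complex.exp (-z * ((s : ℝ) : ℂ)) ∂ν) (n : ℤ)
    {z : ℂ} (hz : 0 < z.re) :
    halfPlaneConv (laplace (hat n)) f z =
      ∫ s, hat n s * h s * Complex.exp (-z * ((s : ℝ) : ℂ)) ∂ν := by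
  have hint : Integrable (fun p : ℝ × ℝ≥0 => (laplace (hat n) (Complex.I * p.1) *
      (h p.2 * Complex.exp (-z * ((p.2 : ℝ) : ℂ)))) *
        Complex.exp ((p.1 * p.2 : ℝ) * Complex.I)) (volume.prod ν) := by
    refine ((integrable_laplace_hat n).mul_prod (integrable_mul_exp hh hz.le)).mul_bdd (c := 1)
      (Measurable.aestronglyMeasurable (by fun_prop)) (ae_of_all _ fun p => ?_)
    rw [Complex.norm_exp_ofReal_mul_I]
  have e1 : ∀ t : ℝ, laplace (hat n) (Complex.I * t) * f (z - Complex.I * t) =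
      ∫ s, (laplace (hat n) (Complex.I * t) * (h s * Complex.exp (-z * ((s : ℝ) : ℂ)))) *
        Complex.exp ((t * s : ℝ) * Complex.I) ∂ν := fun t => by
    rw [hf _ (by simpa using hz), ← integral_const_mul]
    refine integral_congr_ae (ae_of_all _ fun s => ?_)
    simp only
    rw [mul_assoc, mul_assoc, ← Complex.exp_add]
    congr 3
    push_cast
    ring
  unfold halfPlaneConv
  simp_rw [e1]
  rw [integral_integral_swap hint, ← integral_const_mul]
  refine integral_congr_ae (ae_of_all _ fun s => ?_)
  simp only
  rw [← integral_laplace_hat_mul_exp n s, mul_assoc, mul_assoc, ← integral_mul_const]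
  congr 1
  refine integral_congr_ae (ae_of_all _ fun t => ?_)
  simp only
  ring

end Convolution

/-! ### Laplace transforms of measures and Besov membership -/

section LaplaceTransform

variable {ν : Measure ℝ≥0} {h : ℝ≥0 → ℂ}

theorem enorm_le_supNorm (f : ℂ → ℂ) {z : ℂ} (hz : 0 < z.re) : ‖f z‖ₑ ≤ supNorm f :=
  le_iSup₂ (f := fun z (_ : z ∈ rightHalfPlane) => ‖f z‖ₑ) z hz

theorem supNorm_le_lintegral {k : ℝ≥0 → ℂ} {g : ℂ → ℂ}
    (hg : ∀ z : ℂ, 0 < z.re → g z = ∫ s, k s * Complex.exp (-z * ((s : ℝ) : ℂ)) ∂ν) :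
    supNorm g ≤ ∫⁻ s, ‖k s‖ₑ ∂ν := by
  refine iSup₂_le fun z hz => ?_
  rw [hg z hz]
  refine (enorm_integral_le_lintegral_enorm _).trans (lintegral_mono fun s => ?_)
  rw [enorm_mul]
  refine mul_le_of_le_one_right' ?_
  rw [← ofReal_norm, ENNReal.ofReal_le_one]
  exact norm_exp_neg_mul_le_one (le_of_lt hz) s

/-- The Fourier transform is controlled by the Laplace transform on the half-plane. -/
theorem norm_integral_mul_exp_I_le {k : ℝ≥0 → ℂ} (hk : Integrable k ν) {g : ℂ → ℂ}
    (hg : ∀ z : ℂ, 0 < z.re → g z = ∫ s, k s * Complex.exp (-z * ((s : ℝ) : ℂ)) ∂ν)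
    (hfin : supNorm g ≠ ∞) (ω : ℝ) :
    ‖∫ s, k s * Complex.exp (-(ω * s : ℝ) * Complex.I) ∂ν‖ ≤ (supNorm g).toReal := by
  -- The imaginary axis is approached from inside the half-plane along ε + iω, with dominated
  -- convergence.
  have hlim : Tendsto (fun ε : ℝ => ∫ s, k s *
      Complex.exp (-((ε : ℂ) + ω * Complex.I) * ((s : ℝ) : ℂ)) ∂ν) (𝓝[>] 0)
      (𝓝 (∫ s, k s * Complex.exp (-(ω * s : ℝ) * Complex.I) ∂ν)) := by
    refine tendsto_integral_filter_of_dominated_convergence (fun s => ‖k s‖) ?_ ?_ hk.norm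
      (ae_of_all _ fun s => ?_)
    · exact Eventually.of_forall fun ε =>
        hk.aestronglyMeasurable.mul (Measurable.aestronglyMeasurable (by fun_prop))
    · filter_upwards [self_mem_nhdsWithin] with ε hε
      refine ae_of_all _ fun s => ?_
      rw [norm_mul]
      refine mul_le_of_le_one_right (norm_nonneg _) (norm_exp_neg_mul_le_one ?_ s)
      simpa using le_of_lt hε
    · have hc : Continuous fun ε : ℝ =>
          k s * Complex.exp (-((ε : ℂ) + ω * Complex.I) * ((s : ℝ) : ℂ)) := by fun_prop
      refine (hc.tendsto' 0 _ ?_).mono_left nhdsWithin_le_nhds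
      congr 2
      push_cast
      ring
  refine le_of_tendsto hlim.norm ?_
  filter_upwards [self_mem_nhdsWithin] with ε hε
  have hε' : 0 < ((ε : ℂ) + ω * Complex.I).re := by simpa using hε
  rw [← hg _ hε', ← toReal_enorm]
  exact ENNReal.toReal_mono hfin (enorm_le_supNorm g hε')

/-- The kernel tends to 0 except at s = 0, so only the atom at 0 survives, which is exactly the part
of the measure that no hat sees. -/
theorem tendsto_laplace_atTop (hh : Integrable h ν) {f : ℂ → ℂ}
    (hf : ∀ z : ℂ, 0 < z.re → f z = ∫ s, h s * Complex.exp (-z * ((s : ℝ) : ℂ)) ∂ν) :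
    Tendsto (fun t : ℝ => f t) atTop (𝓝 (ν.real {0} • h 0)) := by
  have hlim : Tendsto (fun t : ℝ => ∫ s, h s * Complex.exp (-(t : ℂ) * ((s : ℝ) : ℂ)) ∂ν) atTop
      (𝓝 (∫ s, ({0} : Set ℝ≥0).indicator h s ∂ν)) := by
    refine tendsto_integral_filter_of_dominated_convergence (fun s => ‖h s‖) ?_ ?_ hh.norm
      (ae_of_all _ fun s => ?_)
    · exact Eventually.of_forall fun t =>
        hh.aestronglyMeasurable.mul (Measurable.aestronglyMeasurable (by fun_prop))
    · filter_upwards [eventually_ge_atTop 0] with t ht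
      refine ae_of_all _ fun s => ?_
      rw [norm_mul]
      exact mul_le_of_le_one_right (norm_nonneg _) (norm_exp_neg_mul_le_one (by simpa using ht) s)
    · rcases eq_or_ne s 0 with rfl | hs
      · simp
      · rw [Set.indicator_of_notMem (by simpa using hs), tendsto_zero_iff_norm_tendsto_zero]
        have hs' : 0 < (s : ℝ) := NNReal.coe_pos.2 (pos_iff_ne_zero.2 hs)
        have h1 : Tendsto (fun t : ℝ => ‖h s‖ * Real.exp (-(t * s))) atTop (𝓝 (‖h s‖ * 0)) :=
          (Real.tendsto_exp_neg_atTop_nhds_zero.comp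
            (tendsto_id.atTop_mul_const hs')).const_mul _
        rw [mul_zero] at h1
        refine h1.congr fun t => ?_
        rw [norm_mul, Complex.norm_exp]
        simp
  rw [integral_indicator (measurableSet_singleton 0), integral_singleton] at hlim
  refine hlim.congr' ?_
  filter_upwards [eventually_gt_atTop 0] with t ht
  rw [hf _ (by simpa using ht)]

theorem differentiableOn_laplace (hh : Integrable h ν) {f : ℂ → ℂ}
    (hf : ∀ z : ℂ, 0 < z.re → f z = ∫ s, h s * Complex.exp (-z * ((s : ℝ) : ℂ)) ∂ν) :
    DifferentiableOn ℂ f rightHalfPlane := by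
  have hopen : IsOpen rightHalfPlane := isOpen_lt continuous_const Complex.continuous_re
  suffices H : DifferentiableOn ℂ (fun z => ∫ s, h s * Complex.exp (-z * ((s : ℝ) : ℂ)) ∂ν)
      rightHalfPlane from H.congr fun z hz => hf z hz
  intro z hz
  have hz : 0 < z.re := hz
  -- For Re w > r the s-factor from differentiation is harmless: s·r ≤ s·Re w ≤ exp(s·Re w), which
  -- gives the bound 1/r.
  set r := z.re / 2 with hr
  have hr0 : 0 < r := by positivity
  have hs : {w : ℂ | r < w.re} ∈ 𝓝 z :=
    (isOpen_lt continuous_const Complex.continuous_re).mem_nhds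
      (by simp only [Set.mem_ofPred_eq]; linarith)
  refine (hasDerivAt_integral_of_dominated_loc_of_deriv_le (bound := fun s => ‖h s‖ * (1 / r))
    (F' := fun z s => h s * (Complex.exp (-z * ((s : ℝ) : ℂ)) * (-1 * ((s : ℝ) : ℂ)))) hs ?_
    (integrable_mul_exp hh hz.le) ?_ (ae_of_all _ fun s w hw => ?_) (hh.norm.mul_const _)
    (ae_of_all _ fun s w _ => ?_)).2.differentiableAt.differentiableWithinAt
  · exact Eventually.of_forall fun w =>
      hh.aestronglyMeasurable.mul (Measurable.aestronglyMeasurable (by fun_prop))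
  · exact hh.aestronglyMeasurable.mul (Measurable.aestronglyMeasurable (by fun_prop))
  · have hw : r < w.re := hw
    rw [norm_mul]
    gcongr
    rw [norm_mul, Complex.norm_exp, le_div_iff₀ hr0]
    have e1 : (-w * ((s : ℝ) : ℂ)).re = -(w.re * s) := by simp
    have e2 : ‖(-1 * ((s : ℝ) : ℂ))‖ = s := by simp
    rw [e1, e2, Real.exp_neg, mul_assoc, inv_mul_le_one₀ (Real.exp_pos _)]
    have h1 : (s : ℝ) * r ≤ w.re * s := by
      rw [mul_comm]
      gcongr
    linarith [Real.add_one_le_exp (w.re * s)]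
  · exact ((((hasDerivAt_id w).neg).mul_const _).cexp).const_mul _

theorem tsum_lintegral_hat_le [SFinite ν] (hb : ∀ s, ‖h s‖ ≤ 1) :
    ∑' n : ℤ, ∫⁻ s, ‖(hat n s : ℂ) * h s‖ₑ ∂ν ≤ ν Set.univ := by
  calc ∑' n : ℤ, ∫⁻ s, ‖(hat n s : ℂ) * h s‖ₑ ∂ν
      ≤ ∑' n : ℤ, ∫⁻ s : ℝ≥0, ENNReal.ofReal (hat n s) ∂ν := by
        refine ENNReal.tsum_le_tsum fun n => lintegral_mono fun s => ?_
        rw [← ofReal_norm, norm_mul, Complex.norm_real, Real.norm_eq_abs,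
          abs_of_nonneg (hat_nonneg _ _)]
        exact ENNReal.ofReal_le_ofReal (mul_le_of_le_one_right (hat_nonneg _ _) (hb s))
    _ = ∫⁻ s : ℝ≥0, ∑' n : ℤ, ENNReal.ofReal (hat n s) ∂ν := by
        refine (lintegral_tsum fun n => ?_).symm
        have := (continuous_hat n).measurable
        exact Measurable.aemeasurable (by fun_prop)
    _ ≤ ∫⁻ s : ℝ≥0, 1 ∂ν := by
        refine lintegral_mono fun s => ?_
        rcases eq_or_ne s 0 with rfl | hs
        · have : ∀ n : ℤ, hat n 0 = 0 := fun n => hat_of_le (by positivity)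
          simp [this]
        · have hs' := hasSum_hat (NNReal.coe_pos.2 (pos_iff_ne_zero.2 hs))
          rw [← ENNReal.ofReal_tsum_of_nonneg (fun n => hat_nonneg n s) hs'.summable, hs'.tsum_eq]
          simp
    _ = ν Set.univ := by simp

theorem tsum_int_eq_add (F : ℤ → ℝ≥0∞) :
    ∑' n, F n = ∑' k : ℕ, F (-((k : ℤ) + 1)) + ∑' k : ℕ, F k := by
  rw [tsum_of_nat_of_neg_add_one ENNReal.summable ENNReal.summable, add_comm]

/-- The n-th block is at most ∫ φₙ|h| dν, and these sum to at most the total mass. Bounded support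
leaves only finitely many n ≥ 0, so the weights stay bounded. -/
theorem memBesov_laplace [IsFiniteMeasure ν] (hm : Measurable h) (hb : ∀ s, ‖h s‖ ≤ 1) {f : ℂ → ℂ}
    (hf : ∀ z : ℂ, 0 < z.re → f z = ∫ s, h s * Complex.exp (-z * ((s : ℝ) : ℂ)) ∂ν)
    {R : ℝ} (hR : ∀ᵐ s : ℝ≥0 ∂ν, (s : ℝ) ≤ R) {σ : ℝ} (hσ : 0 ≤ σ) : MemBesov σ f := by
  have hh : Integrable h ν := Integrable.of_bound hm.aestronglyMeasurable 1 (ae_of_all _ hb)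
  have hlim := tendsto_laplace_atTop hh hf
  have hconv : ∀ n : ℤ, supNorm (halfPlaneConv (laplace (hat n)) f) ≤
      ∫⁻ s, ‖(hat n s : ℂ) * h s‖ₑ ∂ν := fun n =>
    supNorm_le_lintegral fun z hz => halfPlaneConv_laplace_hat hh hf n hz
  have htot := tsum_lintegral_hat_le (ν := ν) hb
  rw [tsum_int_eq_add] at htot
  refine ⟨differentiableOn_laplace hh hf, ?_, ⟨_, hlim⟩, ?_⟩
  · refine (supNorm_le_lintegral hf).trans_lt ?_
    exact hh.2
  -- For k > K, `hat k` starts at 2^(k-1) ≥ 2^K > R, beyond the support.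
  · obtain ⟨K, hK⟩ := pow_unbounded_of_one_lt R (one_lt_two (α := ℝ))
    have hzero : ∀ k : ℕ, K < k → ∫⁻ s, ‖(hat k s : ℂ) * h s‖ₑ ∂ν = 0 := fun k hk => by
      rw [lintegral_eq_zero_iff' (by
        have := (continuous_hat k).measurable
        exact Measurable.aemeasurable (by fun_prop))]
      filter_upwards [hR] with s hs
      have h1 : (2 : ℝ) ^ K ≤ 2 ^ ((k : ℤ) - 1) := by
        rw [← zpow_natCast]
        exact zpow_le_zpow_right₀ one_le_two (by lia)
      simp [hat_of_le (hs.trans (hK.le.trans h1))]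
    have hpos : ∑' k : ℕ, (2 : ℝ≥0∞) ^ ((k : ℝ) * σ) *
        supNorm (halfPlaneConv (laplace (hat (k : ℤ))) f) ≤
        (2 : ℝ≥0∞) ^ ((K : ℝ) * σ) * ∑' k : ℕ, ∫⁻ s, ‖(hat k s : ℂ) * h s‖ₑ ∂ν := by
      rw [← ENNReal.tsum_mul_left]
      refine ENNReal.tsum_le_tsum fun k => ?_
      rcases le_or_gt k K with hk | hk
      · refine mul_le_mul' (ENNReal.rpow_le_rpow_of_exponent_le (by norm_num) ?_) (hconv k)
        gcongr
      · have := hconv k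
        rw [hzero k hk, nonpos_iff_eq_zero] at this
        rw [this]
        simp
    have hn : ∑' k : ℕ, ∫⁻ s, ‖(hat (-((k : ℤ) + 1)) s : ℂ) * h s‖ₑ ∂ν < ∞ :=
      (le_self_add.trans htot).trans_lt (measure_lt_top _ _)
    have hp : ∑' k : ℕ, ∫⁻ s, ‖(hat (k : ℤ) s : ℂ) * h s‖ₑ ∂ν < ∞ :=
      (le_add_self.trans htot).trans_lt (measure_lt_top _ _)
    unfold besovNorm
    refine ENNReal.add_lt_top.2 ⟨ENNReal.add_lt_top.2 ⟨enorm_lt_top, ?_⟩, ?_⟩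
    · exact (ENNReal.tsum_le_tsum fun k => hconv _).trans_lt hn
    · refine hpos.trans_lt (ENNReal.mul_lt_top ?_ hp)
      exact ENNReal.rpow_lt_top_of_nonneg (by positivity) (by norm_num)

end LaplaceTransform

/-! ### Growth factors on dyadic blocks -/

theorem rpow_dyadic_le_of_neg {α : ℝ} (hα : 0 ≤ α) (k : ℕ) :
    (1 + (2 : ℝ) ^ ((-((k : ℤ) + 1)) - 1)) ^ α * (1 + (2 : ℝ) ^ ((-((k : ℤ) + 1)) + 1)) ^ α ≤
      9 ^ α := by
  have h1 : (2 : ℝ) ^ ((-((k : ℤ) + 1)) - 1) ≤ 2 ^ (0 : ℤ) :=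
    zpow_le_zpow_right₀ one_le_two (by lia)
  have h2 : (2 : ℝ) ^ ((-((k : ℤ) + 1)) + 1) ≤ 2 ^ (0 : ℤ) :=
    zpow_le_zpow_right₀ one_le_two (by lia)
  rw [zpow_zero] at h1 h2
  rw [← Real.mul_rpow (by positivity) (by positivity)]
  refine Real.rpow_le_rpow (by positivity) ?_ hα
  have h3 : (0 : ℝ) < 2 ^ ((-((k : ℤ) + 1)) - 1) := by positivity
  have h4 : (0 : ℝ) < 2 ^ ((-((k : ℤ) + 1)) + 1) := by positivity
  nlinarith

/-- With K = 2^k ≥ 1 the base is (1 + K/2)(1 + 2K) = 1 + 5K/2 + K² ≤ 9K². The exponent 2α of the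
Besov weight is born here, from one factor of order 2^(kα) at each end of the block. -/
theorem rpow_dyadic_le {α : ℝ} (hα : 0 ≤ α) (k : ℕ) :
    (1 + (2 : ℝ) ^ ((k : ℤ) - 1)) ^ α * (1 + (2 : ℝ) ^ ((k : ℤ) + 1)) ^ α ≤
      9 ^ α * 2 ^ ((k : ℝ) * (2 * α)) := by
  have e1 : (2 : ℝ) ^ ((k : ℝ) * (2 * α)) = ((2 ^ k) ^ 2) ^ α := by
    rw [← pow_mul, ← Real.rpow_natCast, ← Real.rpow_mul zero_le_two]
    congr 1
    push_cast
    ring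
  rw [e1, ← Real.mul_rpow (by positivity) (by positivity),
    ← Real.mul_rpow (by positivity) (by positivity)]
  refine Real.rpow_le_rpow (by positivity) ?_ hα
  rw [zpow_sub_one₀ two_ne_zero, zpow_add_one₀ two_ne_zero, zpow_natCast]
  have h1 : (1 : ℝ) ≤ 2 ^ k := one_le_pow₀ one_le_two
  nlinarith

/-! ### The Besov bound for the calculus -/

section Calculus

variable {X : Type*} [NormedAddCommGroup X] [InnerProductSpace ℂ X] [CompleteSpace X]
  {T : ℝ≥0 → X →L[ℂ] X} {ν : Measure ℝ≥0} [IsFiniteMeasure ν] {h : ℝ≥0 → ℂ} {f : ℂ → ℂ}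

/-- Transference with a = 2^(n-1), b = 2^(n+1); the factor 2 is √(b/a), independent of n. -/
theorem enorm_integral_hat_semigroup_le (hT : IsC0Semigroup T) {M α : ℝ} (hM : 0 ≤ M) (hα : 0 ≤ α)
    (hTM : ∀ s : ℝ≥0, ‖T s‖ ≤ M * (1 + (s : ℝ)) ^ α) (hh : Integrable h ν)
    (hf : ∀ z : ℂ, 0 < z.re → f z = ∫ s, h s * Complex.exp (-z * ((s : ℝ) : ℂ)) ∂ν)
    (n : ℤ) {E : ℝ}
    (hE : (1 + (2 : ℝ) ^ (n - 1)) ^ α * (1 + (2 : ℝ) ^ (n + 1)) ^ α ≤ E) (x : X) :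
    ‖∫ s, ((hat n s : ℂ) * h s) • T s x ∂ν‖ₑ ≤
      ENNReal.ofReal (2 * M ^ 2 * E) * supNorm (halfPlaneConv (laplace (hat n)) f) * ‖x‖ₑ := by
  have hk : Integrable (fun s : ℝ≥0 => (hat n s : ℂ) * h s) ν := by
    refine hh.bdd_mul (c := 1) ?_ (ae_of_all _ fun s => ?_)
    · have := (continuous_hat n).measurable
      exact Measurable.aestronglyMeasurable (by fun_prop)
    · rw [Complex.norm_real, Real.norm_eq_abs, abs_of_nonneg (hat_nonneg _ _)]
      exact hat_le_one _ _
  have hconv : ∀ z : ℂ, 0 < z.re → halfPlaneConv (laplace (hat n)) f z =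
      ∫ s, (hat n s : ℂ) * h s * Complex.exp (-z * ((s : ℝ) : ℂ)) ∂ν :=
    fun z hz => halfPlaneConv_laplace_hat hh hf n hz
  have hfin : supNorm (halfPlaneConv (laplace (hat n)) f) ≠ ∞ :=
    ((supNorm_le_lintegral hconv).trans_lt hk.2).ne
  have hab : (2 : ℝ) ^ (n - 1) ≤ 2 ^ (n + 1) := zpow_le_zpow_right₀ one_le_two (by lia)
  have hsqrt : √((2 : ℝ) ^ (n + 1) / 2 ^ (n - 1)) = 2 := by
    rw [← zpow_sub₀ two_ne_zero, show n + 1 - (n - 1) = 2 by ring,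
      show (2 : ℝ) ^ (2 : ℤ) = 2 ^ 2 by norm_cast, Real.sqrt_sq zero_le_two]
  have hgrow : ∀ b : ℝ, ∀ s : ℝ≥0, (s : ℝ) ≤ b → ‖T s‖ ≤ M * (1 + b) ^ α := fun b s hs =>
    (hTM s).trans (by gcongr)
  have key := norm_integral_semigroup_le hT hk (by positivity) hab
    (fun s hs => mem_Icc_of_hat_ne_zero fun h0 => hs (by rw [h0]; simp))
    (hgrow _) (hgrow _) (norm_integral_mul_exp_I_le hk hconv hfin) x
  rw [hsqrt] at key
  set C := (supNorm (halfPlaneConv (laplace (hat n)) f)).toReal with hC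
  have hle : ‖∫ s, ((hat n s : ℂ) * h s) • T s x ∂ν‖ ≤ 2 * M ^ 2 * E * C * ‖x‖ := by
    refine key.trans ?_
    have hC0 : 0 ≤ C := ENNReal.toReal_nonneg
    calc _ = 2 * M ^ 2 * ((1 + (2 : ℝ) ^ (n - 1)) ^ α * (1 + (2 : ℝ) ^ (n + 1)) ^ α) * C * ‖x‖ := by
          ring
      _ ≤ _ := by gcongr
  have hE0 : 0 ≤ E := hE.trans' (by positivity)
  rw [← ofReal_norm, ← ofReal_norm, ← ENNReal.ofReal_toReal hfin,
    ← ENNReal.ofReal_mul (by positivity), ← ENNReal.ofReal_mul (by positivity)]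
  exact ENNReal.ofReal_le_ofReal hle

/-- The Hille-Phillips calculus of a semigroup on a Hilbert space is bounded in the Besov norm. -/
theorem exists_bounded_integral (hT : IsC0Semigroup T) {M α : ℝ} (hM : 1 ≤ M) (hα : 0 ≤ α)
    (hTM : ∀ s : ℝ≥0, ‖T s‖ ≤ M * (1 + (s : ℝ)) ^ α) (hm : Measurable h) (hb : ∀ s, ‖h s‖ ≤ 1)
    (hf : ∀ z : ℂ, 0 < z.re → f z = ∫ s, h s * Complex.exp (-z * ((s : ℝ) : ℂ)) ∂ν)
    {B : ℝ} (hB : ∀ᵐ s ∂ν, ‖T s‖ ≤ B) :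
    ∃ S : X →L[ℂ] X, (∀ x, Integrable (fun s => T s x) ν ∧ S x = ∫ s, h s • T s x ∂ν) ∧
      ‖S‖ₑ ≤ ENNReal.ofReal (2 * 9 ^ α * M ^ 2) * besovNorm (2 * α) f := by
  have hh : Integrable h ν := Integrable.of_bound hm.aestronglyMeasurable 1 (ae_of_all _ hb)
  have hTx : ∀ x, ∀ᵐ s ∂ν, ‖T s x‖ ≤ B * ‖x‖ := fun x => by
    filter_upwards [hB] with s hs
    exact (T s).le_of_opNorm_le hs x
  have hTi : ∀ x, Integrable (fun s => T s x) ν := fun x =>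
    Integrable.of_bound (hT.continuous_orbit x).aestronglyMeasurable _ (hTx x)
  have hi : ∀ x, Integrable (fun s => h s • T s x) ν := fun x =>
    (hTi x).bdd_smul 1 hm.aestronglyMeasurable (ae_of_all _ hb)
  have hnorm : ∀ x, ∀ᵐ s ∂ν, ‖h s • T s x‖ ≤ B * ‖x‖ := fun x => by
    filter_upwards [hTx x] with s hs
    rw [norm_smul]
    exact (mul_le_of_le_one_left (norm_nonneg _) (hb s)).trans hs
  let S₀ : X →ₗ[ℂ] X :=
    { toFun := fun x => ∫ s, h s • T s x ∂ν
      map_add' := fun x y => by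
        rw [← integral_add (hi x) (hi y)]
        simp
      map_smul' := fun c x => by
        rw [RingHom.id_apply, ← integral_smul]
        refine integral_congr_ae (ae_of_all _ fun s => ?_)
        simp only [map_smul]
        rw [smul_comm] }
  -- `B` only serves to make the integrals converge and S bounded; the final estimate does not
  -- involve it.
  let S : X →L[ℂ] X := S₀.mkContinuous (B * ν.real Set.univ) fun x => by
    refine (norm_integral_le_of_norm_le_const (hnorm x)).trans (le_of_eq ?_)
    ring
  have hS : ∀ x, S x = ∫ s, h s • T s x ∂ν := fun x => rfl
  refine ⟨S, fun x => ⟨hTi x, hS x⟩, ContinuousLinearMap.opENorm_le_bound _ fun x => ?_⟩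
  -- Dominated convergence, with terms bounded by φₙ(s)·B‖x‖. The point 0 is removed because every
  -- hat vanishes there.
  have hsum : HasSum (fun n : ℤ => ∫ s, ((hat n s : ℂ) * h s) • T s x ∂ν)
      (∫ s, ({0}ᶜ : Set ℝ≥0).indicator (fun s => h s • T s x) s ∂ν) := by
    have hat0 : ∀ n : ℤ, hat n 0 = 0 := fun n => hat_of_le (by positivity)
    have hS1 : ∀ s : ℝ≥0, HasSum (fun n : ℤ => hat n s * (B * ‖x‖))
        (({0}ᶜ : Set ℝ≥0).indicator (fun _ => B * ‖x‖) s) := fun s => by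
      rcases eq_or_ne s 0 with rfl | hs
      · simp [hat0, hasSum_zero]
      · rw [Set.indicator_of_mem (by simpa using hs)]
        simpa using (hasSum_hat (NNReal.coe_pos.2 (pos_iff_ne_zero.2 hs))).mul_right (B * ‖x‖)
    refine hasSum_integral_of_dominated_convergence (fun n s => hat n s * (B * ‖x‖)) (fun n => ?_)
      (fun n => ?_) (ae_of_all _ fun s => (hS1 s).summable) ?_ (ae_of_all _ fun s => ?_)
    · have h1 := (continuous_hat n).measurable
      have h2 : Measurable fun s : ℝ≥0 => (hat n s : ℂ) * h s := by fun_prop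
      exact h2.aestronglyMeasurable.smul (hT.continuous_orbit x).aestronglyMeasurable
    · filter_upwards [hnorm x] with s hs
      rw [mul_smul, norm_smul, Complex.norm_real, Real.norm_eq_abs, abs_of_nonneg (hat_nonneg _ _)]
      exact mul_le_mul_of_nonneg_left hs (hat_nonneg _ _)
    · simp_rw [(hS1 _).tsum_eq]
      exact (integrable_const _).indicator (measurableSet_singleton 0).compl
    · rcases eq_or_ne s 0 with rfl | hs
      · simp [hat0, hasSum_zero]
      · rw [Set.indicator_of_mem (by simpa using hs)]
        have h1 := (hasSum_hat (NNReal.coe_pos.2 (pos_iff_ne_zero.2 hs))).smul_const (h s • T s x)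
        rw [one_smul] at h1
        refine h1.congr_fun fun n => ?_
        rw [mul_smul, Complex.coe_smul]
  have hval : valueAtInfinity f = ν.real {0} • h 0 := (tendsto_laplace_atTop hh hf).limUnder_eq
  have hsplit : S x = valueAtInfinity f • x +
      ∑' n : ℤ, ∫ s, ((hat n s : ℂ) * h s) • T s x ∂ν := by
    rw [hS, hsum.tsum_eq, integral_indicator (measurableSet_singleton 0).compl,
      ← integral_add_compl (measurableSet_singleton 0) (hi x), integral_singleton, hval,
      hT.map_zero, smul_assoc]
    rfl
  have h9 : (1 : ℝ) ≤ 9 ^ α := Real.one_le_rpow (by norm_num) hα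
  set c := ENNReal.ofReal (2 * 9 ^ α * M ^ 2) with hc
  -- This lets the term f(∞)x be absorbed into the common constant.
  have hc1 : 1 ≤ c := by
    rw [hc, ENNReal.one_le_ofReal]
    nlinarith
  have hneg : ∀ k : ℕ, ‖∫ s, ((hat (-((k : ℤ) + 1)) s : ℂ) * h s) • T s x ∂ν‖ₑ ≤
      c * supNorm (halfPlaneConv (laplace (hat (-((k : ℤ) + 1)))) f) * ‖x‖ₑ := fun k => by
    refine (enorm_integral_hat_semigroup_le hT (zero_le_one.trans hM) hα hTM hh hf _
      (rpow_dyadic_le_of_neg hα k) x).trans (le_of_eq ?_)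
    rw [hc]
    congr 3
    ring
  have hpos : ∀ k : ℕ, ‖∫ s, ((hat (k : ℤ) s : ℂ) * h s) • T s x ∂ν‖ₑ ≤
      c * ((2 : ℝ≥0∞) ^ ((k : ℝ) * (2 * α)) *
        supNorm (halfPlaneConv (laplace (hat (k : ℤ))) f)) * ‖x‖ₑ := fun k => by
    refine (enorm_integral_hat_semigroup_le hT (zero_le_one.trans hM) hα hTM hh hf _
      (rpow_dyadic_le hα k) x).trans (le_of_eq ?_)
    have e1 : (2 : ℝ≥0∞) ^ ((k : ℝ) * (2 * α)) = ENNReal.ofReal (2 ^ ((k : ℝ) * (2 * α))) := by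
      rw [← ENNReal.ofReal_rpow_of_pos two_pos]
      simp
    rw [hc, e1, ← mul_assoc (ENNReal.ofReal _), ← ENNReal.ofReal_mul (by positivity)]
    congr 3
    ring
  calc ‖S x‖ₑ ≤ ‖valueAtInfinity f • x‖ₑ +
        ∑' n : ℤ, ‖∫ s, ((hat n s : ℂ) * h s) • T s x ∂ν‖ₑ := by
        rw [hsplit]
        exact (enorm_add_le _ _).trans (add_le_add le_rfl enorm_tsum_le_tsum_enorm)
    _ ≤ c * ‖valueAtInfinity f‖ₑ * ‖x‖ₑ +
        (∑' k : ℕ, c * supNorm (halfPlaneConv (laplace (hat (-((k : ℤ) + 1)))) f) * ‖x‖ₑ +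
        ∑' k : ℕ, c * ((2 : ℝ≥0∞) ^ ((k : ℝ) * (2 * α)) *
          supNorm (halfPlaneConv (laplace (hat (k : ℤ))) f)) * ‖x‖ₑ) := by
        rw [tsum_int_eq_add, enorm_smul]
        refine add_le_add ?_ (add_le_add (ENNReal.tsum_le_tsum hneg) (ENNReal.tsum_le_tsum hpos))
        gcongr
        exact le_mul_of_one_le_left' hc1
    _ = c * besovNorm (2 * α) f * ‖x‖ₑ := by
        simp_rw [ENNReal.tsum_mul_right, ENNReal.tsum_mul_left]
        unfold besovNorm
        ring

end Calculus

end BesovCalculus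

/-! ### The main theorem -/

theorem mainTheorem2 :
    ∃ c : ℝ, 0 ≤ c ∧
      ∀ (X : Type u) [NormedAddCommGroup X] [InnerProductSpace ℂ X] [CompleteSpace X]
        (A : X →ₗ.[ℂ] X) (T : ℝ≥0 → X →L[ℂ] X),
        BesovCalculus.IsC0Semigroup T → BesovCalculus.IsGenerator T (-A) →
        -- polynomially growing semigroups, measures of compact support
        (∀ M α : ℝ, 1 ≤ M → 0 ≤ α → (∀ s : ℝ≥0, ‖T s‖ ≤ M * (1 + (s : ℝ)) ^ α) →
          ∀ μ : ComplexMeasure ℝ≥0, IsCompact μ.variation.support →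
            BesovCalculus.MemBesov (2 * α) (BesovCalculus.laplaceMeasure μ) ∧
            ∃ fA : X →L[ℂ] X, BesovCalculus.IsHillePhillips T μ fA ∧
              ‖fA‖ₑ ≤ ENNReal.ofReal (c * 9 ^ α * M ^ 2) *
                BesovCalculus.besovNorm (2 * α) (BesovCalculus.laplaceMeasure μ)) ∧
        -- bounded semigroups, arbitrary bounded measures
        (∀ M : ℝ, (∀ s : ℝ≥0, ‖T s‖ ≤ M) →
          ∀ μ : ComplexMeasure ℝ≥0,
            ∃ fA : X →L[ℂ] X, BesovCalculus.IsHillePhillips T μ fA ∧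
              ‖fA‖ₑ ≤ ENNReal.ofReal (c * M ^ 2) *
                BesovCalculus.besovNorm 0 (BesovCalculus.laplaceMeasure μ)) := by
  refine ⟨2, zero_le_two, fun X _ _ _ A T hT _ => ?_⟩
  have hlap : ∀ {μ : ComplexMeasure ℝ≥0} {h : ℝ≥0 → ℂ}, Measurable h → (∀ s, ‖h s‖ ≤ 1) →
      (∀ E, MeasurableSet E → μ E = ∫ s in E, h s ∂μ.variation) → ∀ z : ℂ, 0 < z.re →
      BesovCalculus.laplaceMeasure μ z =
        ∫ s, h s * Complex.exp (-z * ((s : ℝ) : ℂ)) ∂μ.variation := fun {μ h} hm hb hμ z hz => by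
    have := BesovCalculus.isFiniteMeasure_variation μ
    exact BesovCalculus.cintegral_eq_integral hm hb hμ (Integrable.of_bound
      (Measurable.aestronglyMeasurable (by fun_prop)) 1
      (ae_of_all _ (BesovCalculus.norm_exp_neg_mul_le_one hz.le)))
  refine ⟨fun M α hM hα hTM μ hμc => ?_, fun M hTM μ => ?_⟩
  · have := BesovCalculus.isFiniteMeasure_variation μ
    obtain ⟨h, hm, hb, hμ⟩ := BesovCalculus.exists_density μ
    obtain ⟨R, hR⟩ := hμc.bddAbove
    have hsupp : ∀ᵐ s : ℝ≥0 ∂μ.variation, (s : ℝ) ≤ R := by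
      filter_upwards [Measure.support_mem_ae (μ := μ.variation)] with s hs
      exact NNReal.coe_le_coe.2 (hR hs)
    refine ⟨BesovCalculus.memBesov_laplace hm hb (hlap hm hb hμ) hsupp (by positivity), ?_⟩
    obtain ⟨S, hS, hS'⟩ := BesovCalculus.exists_bounded_integral hT hM hα hTM hm hb
      (hlap hm hb hμ) (B := M * (1 + (R : ℝ)) ^ α) (by
        filter_upwards [hsupp] with s hs
        refine (hTM s).trans ?_
        gcongr)
    refine ⟨S, fun x => ⟨(hS x).1, ?_⟩, hS'⟩
    rw [(hS x).2, BesovCalculus.cintegral_eq_integral hm hb hμ (hS x).1]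
  · have := BesovCalculus.isFiniteMeasure_variation μ
    obtain ⟨h, hm, hb, hμ⟩ := BesovCalculus.exists_density μ
    -- M ≥ 1 is not assumed in the bounded case; it follows from ‖T(0)‖ = 1 unless X = 0, which is
    -- trivial.
    rcases subsingleton_or_nontrivial X with hX | hX
    · refine ⟨0, fun x => ⟨?_, Subsingleton.elim _ _⟩, by simp⟩
      exact (integrable_zero _ _ _).congr (ae_of_all _ fun s => Subsingleton.elim _ _)
    · have hM : 1 ≤ M := by
        have := hTM 0
        rwa [hT.map_zero, norm_one] at this
      obtain ⟨S, hS, hS'⟩ := BesovCalculus.exists_bounded_integral hT hM le_rfl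
        (by simpa using hTM) hm hb (hlap hm hb hμ) (ae_of_all _ hTM)
      refine ⟨S, fun x => ⟨(hS x).1, ?_⟩, by simpa using hS'⟩
      rw [(hS x).2, BesovCalculus.cintegral_eq_integral hm hb hμ (hS x).1]
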